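/- The rank of a tensor $T\in\mathbb C^2\otimes\mathbb C^b\otimes\mathbb C^c$ is the least number $n$ such that $T$ is a sum of $n$ decomposable tensors $u\otimes v\otimes w$. Let $b,c\ge 0$ be integers. Then the ranks of the tensors in $\mathbb C^2\otimes\mathbb C^b\otimes\mathbb C^c$ have a maximum $r$, and the maximal rank of a tensor in $\mathbb C^2\otimes\mathbb C^b\otimes\mathbb C^{c+1}$ exists and is - either $r$ or $r+1$, if $c+1\ge b$; - one of $r$, $r+1$, $r+2$, if $c+1<b$. -/

import Mathlib

open scoped TensorProduct

/-- `HasRankOneDecomp T n`: the three-factor tensor `T` is a sum of `n` decomposable tensors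
`u ⊗ v ⊗ w`. (Vanishing summands are allowed, so this says that `n` summands suffice.) -/
def HasRankOneDecomp {K A B C : Type*} [Field K] [AddCommGroup A] [AddCommGroup B]
    [AddCommGroup C] [Module K A] [Module K B] [Module K C]
    (T : A ⊗[K] (B ⊗[K] C)) (n : ℕ) : Prop :=
  ∃ (u : Fin n → A) (v : Fin n → B) (w : Fin n → C), T = ∑ i, u i ⊗ₜ[K] (v i ⊗ₜ[K] w i)

/-- The rank of a three-factor tensor: the least number of decomposable tensors of which it is
the sum. The infimum is over a nonempty set, see `exists_hasRankOneDecomp`. -/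
noncomputable def tensorRank {K A B C : Type*} [Field K] [AddCommGroup A] [AddCommGroup B]
    [AddCommGroup C] [Module K A] [Module K B] [Module K C]
    (T : A ⊗[K] (B ⊗[K] C)) : ℕ :=
  sInf {n : ℕ | HasRankOneDecomp T n}

theorem HasRankOneDecomp.add {K A B C : Type*} [Field K] [AddCommGroup A] [AddCommGroup B]
    [AddCommGroup C] [Module K A] [Module K B] [Module K C]
    {S T : A ⊗[K] (B ⊗[K] C)} {m n : ℕ} (hS : HasRankOneDecomp S m)
    (hT : HasRankOneDecomp T n) : HasRankOneDecomp (S + T) (m + n) := by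
  obtain ⟨u, v, w, rfl⟩ := hS
  obtain ⟨u', v', w', rfl⟩ := hT
  exact ⟨Fin.append u u', Fin.append v v', Fin.append w w', by simp [Fin.sum_univ_add]⟩

theorem exists_hasRankOneDecomp {K A B C : Type*} [Field K] [AddCommGroup A] [AddCommGroup B]
    [AddCommGroup C] [Module K A] [Module K B] [Module K C]
    (T : A ⊗[K] (B ⊗[K] C)) : ∃ n, HasRankOneDecomp T n := by
  induction T using TensorProduct.induction_on with
  | zero => exact ⟨0, Fin.elim0, Fin.elim0, Fin.elim0, by simp⟩
  | add S T hS hT =>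
    obtain ⟨m, hm⟩ := hS
    obtain ⟨n, hn⟩ := hT
    exact ⟨m + n, hm.add hn⟩
  | tmul a y =>
    induction y using TensorProduct.induction_on with
    | zero => exact ⟨0, Fin.elim0, Fin.elim0, Fin.elim0, by simp⟩
    | add S T hS hT =>
      obtain ⟨m, hm⟩ := hS
      obtain ⟨n, hn⟩ := hT
      exact ⟨m + n, by rw [TensorProduct.tmul_add]; exact hm.add hn⟩
    | tmul b c => exact ⟨1, fun _ => a, fun _ => b, fun _ => c, by simp⟩

theorem hasRankOneDecomp_tensorRank {K A B C : Type*} [Field K] [AddCommGroup A]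
    [AddCommGroup B] [AddCommGroup C] [Module K A] [Module K B] [Module K C]
    (T : A ⊗[K] (B ⊗[K] C)) : HasRankOneDecomp T (tensorRank T) :=
  Nat.sInf_mem (exists_hasRankOneDecomp T)

/-- `r` is the maximal rank of a tensor in `ℂ^a ⊗ ℂ^b ⊗ ℂ^c`: it is attained, and no tensor
has larger rank. -/
def IsMaximalRank (a b c r : ℕ) : Prop :=
  IsGreatest
    (Set.range fun T : (Fin a → ℂ) ⊗[ℂ] ((Fin b → ℂ) ⊗[ℂ] (Fin c → ℂ)) => tensorRank T) r

/-! Write a tensor as `e₀ ⊗ X + e₁ ⊗ Y`. Given a form `φ` on the last factor and `w` with `φ w = 1`,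
projecting along `w` onto `ker φ` leaves a tensor of format `2 × b × c`, of rank at most `r`. The
remainder is `e₀ ⊗ X(φ) ⊗ w + e₁ ⊗ Y(φ) ⊗ w`, whence `r + 2`. If `b ≤ c + 1`, an eigenvalue argument
(`exists_ne_zero_proportional_images`) yields `φ ≠ 0` with `X(φ)` and `Y(φ)` on one line. The
remainder is then decomposable, whence `r + 1`. The lower bound `r` holds because a split embedding
preserves rank. -/

section Rank

variable {K A B C C' : Type*} [Field K] [AddCommGroup A] [AddCommGroup B] [AddCommGroup C]
  [AddCommGroup C'] [Module K A] [Module K B] [Module K C] [Module K C']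

theorem tensorRank_le {T : A ⊗[K] (B ⊗[K] C)} {n : ℕ} (h : HasRankOneDecomp T n) :
    tensorRank T ≤ n :=
  Nat.sInf_le h

theorem hasRankOneDecomp_tmul (a : A) (b : B) (c : C) :
    HasRankOneDecomp (a ⊗ₜ[K] (b ⊗ₜ[K] c)) 1 :=
  ⟨fun _ => a, fun _ => b, fun _ => c, by simp⟩

theorem HasRankOneDecomp.lTensor {T : A ⊗[K] (B ⊗[K] C)} {n : ℕ} (h : HasRankOneDecomp T n)
    (f : C →ₗ[K] C') : HasRankOneDecomp ((f.lTensor B).lTensor A T) n := by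
  obtain ⟨u, v, w, rfl⟩ := h
  exact ⟨u, v, fun i => f (w i), by simp⟩

theorem tensorRank_lTensor_le (T : A ⊗[K] (B ⊗[K] C)) (f : C →ₗ[K] C') :
    tensorRank ((f.lTensor B).lTensor A T) ≤ tensorRank T :=
  tensorRank_le ((hasRankOneDecomp_tensorRank T).lTensor f)

theorem lTensor_lTensor_comp_apply {C'' : Type*} [AddCommGroup C''] [Module K C'']
    (T : A ⊗[K] (B ⊗[K] C)) (f : C →ₗ[K] C') (g : C' →ₗ[K] C'') :
    (g.lTensor B).lTensor A ((f.lTensor B).lTensor A T) =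
      ((g ∘ₗ f).lTensor B).lTensor A T := by
  rw [← LinearMap.comp_apply, ← LinearMap.lTensor_comp, ← LinearMap.lTensor_comp]

theorem tensorRank_lTensor_of_leftInverse (T : A ⊗[K] (B ⊗[K] C)) {f : C →ₗ[K] C'}
    {g : C' →ₗ[K] C} (h : g ∘ₗ f = LinearMap.id) :
    tensorRank ((f.lTensor B).lTensor A T) = tensorRank T := by
  refine le_antisymm (tensorRank_lTensor_le T f) ?_
  have := tensorRank_lTensor_le ((f.lTensor B).lTensor A T) g
  rwa [lTensor_lTensor_comp_apply, h, LinearMap.lTensor_id, LinearMap.lTensor_id,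
    LinearMap.id_apply] at this

variable (K B C) in
/-- Contraction of `B ⊗ C` in its second factor with linear forms on `C`. -/
noncomputable def contractSnd : B ⊗[K] C →ₗ[K] Module.Dual K C →ₗ[K] B :=
  TensorProduct.lift
    (LinearMap.mk₂ K (fun b c => (LinearMap.applyₗ c : Module.Dual K C →ₗ[K] K).smulRight b)
      (by intros; ext; simp)
      (by intros; ext; exact smul_comm _ _ _)
      (by intros; ext; simp [add_smul])
      (by intros; ext; simp [mul_smul]))

@[simp]
theorem contractSnd_tmul (b : B) (c : C) (φ : Module.Dual K C) :
    contractSnd K B C (b ⊗ₜ c) φ = φ c • b := by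
  simp [contractSnd]

/-- A tensor in `B ⊗ C` splits along the decomposition of `C` into `ker φ` and the line of `w`. -/
theorem eq_lTensor_add_contractSnd_tmul (X : B ⊗[K] C) (φ : Module.Dual K C) (w : C) :
    X = (LinearMap.id - φ.smulRight w).lTensor B X + contractSnd K B C X φ ⊗ₜ[K] w := by
  induction X using TensorProduct.induction_on with
  | zero => simp
  | tmul b c => simp [TensorProduct.smul_tmul]
  | add X Y hX hY =>
    rw [map_add, map_add, LinearMap.add_apply, TensorProduct.add_tmul, add_add_add_comm, ← hX,
      ← hY]

theorem exists_eq_tmul_add_tmul (T : (Fin 2 → K) ⊗[K] B) :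
    ∃ X Y : B, T = Pi.single 0 1 ⊗ₜ[K] X + Pi.single 1 1 ⊗ₜ[K] Y := by
  induction T using TensorProduct.induction_on with
  | zero => exact ⟨0, 0, by simp⟩
  | tmul a b =>
    refine ⟨a 0 • b, a 1 • b, ?_⟩
    rw [← TensorProduct.smul_tmul, ← TensorProduct.smul_tmul, ← TensorProduct.add_tmul]
    congr 1
    ext i
    fin_cases i <;> simp
  | add S T hS hT =>
    obtain ⟨X, Y, rfl⟩ := hS
    obtain ⟨X', Y', rfl⟩ := hT
    exact ⟨X + X', Y + Y', by simp only [TensorProduct.tmul_add]; abel⟩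

/-- Over an algebraically closed field, every pencil of linear maps to a space of no larger
dimension has a nonzero vector whose two images are proportional. -/
theorem exists_ne_zero_proportional_images [IsAlgClosed K] [FiniteDimensional K A]
    [FiniteDimensional K B] [Nontrivial A] (h : Module.finrank K B ≤ Module.finrank K A)
    (f g : A →ₗ[K] B) :
    ∃ v : A, v ≠ 0 ∧ ∃ (s t : K) (z : B), f v = s • z ∧ g v = t • z := by
  by_cases hf : LinearMap.ker f = ⊥
  · have hinj := LinearMap.ker_eq_bot.mp hf
    -- The dimension bound makes the injective `f` invertible; an eigenvector of `f⁻¹ g` satisfies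
    -- `g v = μ • f v`.
    let e := LinearEquiv.ofInjectiveOfFinrankEq f hinj
      (le_antisymm (LinearMap.finrank_le_finrank_of_injective hinj) h)
    obtain ⟨μ, hμ⟩ := Module.End.exists_eigenvalue (e.symm.toLinearMap ∘ₗ g)
    obtain ⟨v, hv⟩ := hμ.exists_hasEigenvector
    refine ⟨v, hv.2, 1, μ, f v, (one_smul _ _).symm, ?_⟩
    have := congrArg e hv.apply_eq_smul
    have hev : e v = f v := rfl
    simpa [hev] using this
  · obtain ⟨v, hv, hv0⟩ := Submodule.exists_mem_ne_zero_of_ne_bot hf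
    exact ⟨v, hv0, 0, 1, g v, by simpa using hv, (one_smul _ _).symm⟩

/-- The projection along `w` onto the kernel of `φ` factors through a space of dimension one
less. -/
theorem exists_comp_eq_id_sub_smulRight {c : ℕ} {φ : Module.Dual K (Fin (c + 1) → K)}
    {w : Fin (c + 1) → K} (h : φ w = 1) :
    ∃ (q : (Fin (c + 1) → K) →ₗ[K] (Fin c → K)) (i : (Fin c → K) →ₗ[K] (Fin (c + 1) → K)),
      i ∘ₗ q = LinearMap.id - φ.smulRight w := by
  have hφ : φ ≠ 0 := by
    rintro rfl
    simp at h
  have hfin : Module.finrank K (LinearMap.ker φ) = Module.finrank K (Fin c → K) := by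
    have := Module.Dual.finrank_ker_add_one_of_ne_zero hφ
    simp only [Module.finrank_fin_fun] at this ⊢
    omega
  let e := LinearEquiv.ofFinrankEq _ _ hfin
  refine ⟨e.toLinearMap ∘ₗ (LinearMap.id - φ.smulRight w).codRestrict (LinearMap.ker φ)
    (fun x => by simp [h]), (LinearMap.ker φ).subtype ∘ₗ e.symm.toLinearMap, ?_⟩
  refine LinearMap.ext fun x => ?_
  simp
  rfl

end Rank

section Complex

variable {b c r : ℕ}

/-- The projection factors through `ℂ^c`, and linear maps on a factor do not raise rank. -/
theorem tensorRank_lTensor_id_sub_smulRight_le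
    (hr : ∀ T : (Fin 2 → ℂ) ⊗[ℂ] ((Fin b → ℂ) ⊗[ℂ] (Fin c → ℂ)), tensorRank T ≤ r)
    {φ : Module.Dual ℂ (Fin (c + 1) → ℂ)} {w : Fin (c + 1) → ℂ} (h : φ w = 1)
    (T : (Fin 2 → ℂ) ⊗[ℂ] ((Fin b → ℂ) ⊗[ℂ] (Fin (c + 1) → ℂ))) :
    tensorRank (((LinearMap.id - φ.smulRight w).lTensor (Fin b → ℂ)).lTensor (Fin 2 → ℂ) T)
      ≤ r := by
  obtain ⟨q, i, hqi⟩ := exists_comp_eq_id_sub_smulRight h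
  rw [← hqi, ← lTensor_lTensor_comp_apply]
  exact (tensorRank_lTensor_le _ i).trans (hr _)

theorem tensorRank_add_le {A B C : Type*} [AddCommGroup A] [AddCommGroup B] [AddCommGroup C]
    [Module ℂ A] [Module ℂ B] [Module ℂ C] {S T : A ⊗[ℂ] (B ⊗[ℂ] C)} {m n : ℕ}
    (hS : tensorRank S ≤ m) (hT : HasRankOneDecomp T n) : tensorRank (S + T) ≤ m + n :=
  (tensorRank_le ((hasRankOneDecomp_tensorRank S).add hT)).trans (Nat.add_le_add_right hS n)

theorem tensorRank_succ_le_add_two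
    (hr : ∀ T : (Fin 2 → ℂ) ⊗[ℂ] ((Fin b → ℂ) ⊗[ℂ] (Fin c → ℂ)), tensorRank T ≤ r)
    (T : (Fin 2 → ℂ) ⊗[ℂ] ((Fin b → ℂ) ⊗[ℂ] (Fin (c + 1) → ℂ))) : tensorRank T ≤ r + 2 := by
  obtain ⟨X, Y, rfl⟩ := exists_eq_tmul_add_tmul T
  let φ : Module.Dual ℂ (Fin (c + 1) → ℂ) := LinearMap.proj 0
  have h : φ (Pi.single 0 1) = 1 := by simp [φ]
  rw [eq_lTensor_add_contractSnd_tmul X φ (Pi.single 0 1),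
    eq_lTensor_add_contractSnd_tmul Y φ (Pi.single 0 1),
    TensorProduct.tmul_add, TensorProduct.tmul_add, add_add_add_comm]
  refine tensorRank_add_le ?_ ((hasRankOneDecomp_tmul _ _ _).add (hasRankOneDecomp_tmul _ _ _))
  rw [← LinearMap.lTensor_tmul, ← LinearMap.lTensor_tmul, ← map_add]
  exact tensorRank_lTensor_id_sub_smulRight_le hr h _

theorem tensorRank_succ_le_add_one (hbc : b ≤ c + 1)
    (hr : ∀ T : (Fin 2 → ℂ) ⊗[ℂ] ((Fin b → ℂ) ⊗[ℂ] (Fin c → ℂ)), tensorRank T ≤ r)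
    (T : (Fin 2 → ℂ) ⊗[ℂ] ((Fin b → ℂ) ⊗[ℂ] (Fin (c + 1) → ℂ))) : tensorRank T ≤ r + 1 := by
  obtain ⟨X, Y, rfl⟩ := exists_eq_tmul_add_tmul T
  obtain ⟨φ, hφ, s, t, z, hX, hY⟩ := exists_ne_zero_proportional_images
    (by simpa [Subspace.dual_finrank_eq] using hbc)
    (contractSnd ℂ (Fin b → ℂ) (Fin (c + 1) → ℂ) X) (contractSnd ℂ _ _ Y)
  obtain ⟨w, h⟩ := LinearMap.surjective hφ 1
  -- The two remainder terms merge into `(s • e₀ + t • e₁) ⊗ z ⊗ w`.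
  rw [eq_lTensor_add_contractSnd_tmul X φ w, eq_lTensor_add_contractSnd_tmul Y φ w, hX, hY,
    TensorProduct.tmul_add, TensorProduct.tmul_add, add_add_add_comm,
    ← TensorProduct.smul_tmul', ← TensorProduct.smul_tmul', ← TensorProduct.smul_tmul,
    ← TensorProduct.smul_tmul, ← TensorProduct.add_tmul]
  refine tensorRank_add_le ?_ (hasRankOneDecomp_tmul _ _ _)
  rw [← LinearMap.lTensor_tmul, ← LinearMap.lTensor_tmul, ← map_add]
  exact tensorRank_lTensor_id_sub_smulRight_le hr h _

/-- Any bound will do here: it only serves to make the set of ranks bounded, so that a maximum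
exists. -/
theorem exists_forall_tensorRank_le (b c : ℕ) :
    ∃ r, ∀ T : (Fin 2 → ℂ) ⊗[ℂ] ((Fin b → ℂ) ⊗[ℂ] (Fin c → ℂ)), tensorRank T ≤ r := by
  induction c with
  | zero =>
    refine ⟨0, fun T => tensorRank_le ⟨Fin.elim0, Fin.elim0, Fin.elim0, ?_⟩⟩
    obtain ⟨X, Y, rfl⟩ := exists_eq_tmul_add_tmul T
    rw [Subsingleton.elim X 0, Subsingleton.elim Y 0]
    simp
  | succ c ih =>
    obtain ⟨r, hr⟩ := ih
    exact ⟨r + 2, tensorRank_succ_le_add_two hr⟩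

theorem exists_isMaximalRank (b c : ℕ) : ∃ r, IsMaximalRank 2 b c r := by
  obtain ⟨r, hr⟩ := exists_forall_tensorRank_le b c
  have hbdd : BddAbove (Set.range fun T : (Fin 2 → ℂ) ⊗[ℂ] ((Fin b → ℂ) ⊗[ℂ] (Fin c → ℂ)) =>
      tensorRank T) := ⟨r, by rintro _ ⟨T, rfl⟩; exact hr T⟩
  exact hbdd.exists_isGreatest_of_nonempty (Set.range_nonempty _)

theorem IsMaximalRank.tensorRank_le {a : ℕ} (h : IsMaximalRank a b c r)
    (T : (Fin a → ℂ) ⊗[ℂ] ((Fin b → ℂ) ⊗[ℂ] (Fin c → ℂ))) : tensorRank T ≤ r :=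
  h.2 ⟨T, rfl⟩

theorem IsMaximalRank.le_succ {a s : ℕ} (h : IsMaximalRank a b c r)
    (h' : IsMaximalRank a b (c + 1) s) : r ≤ s := by
  obtain ⟨T, rfl⟩ := h.1
  -- Dropping the last coordinate undoes extension by zero.
  have hinv : LinearMap.funLeft ℂ ℂ (Fin.castSucc : Fin c → Fin (c + 1)) ∘ₗ
      (Function.ExtendByZero.linearMap ℂ (Fin.castSucc : Fin c → Fin (c + 1))) =
      LinearMap.id := by
    refine LinearMap.ext fun x => funext fun i => ?_
    simp [LinearMap.funLeft_apply, (Fin.castSucc_injective c).extend_apply]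
  exact (tensorRank_lTensor_of_leftInverse T hinv).symm.le.trans (h'.tensorRank_le _)

end Complex

theorem corollary5p1 (b c : ℕ) :
    (∃ r : ℕ, IsMaximalRank 2 b c r) ∧
      ∀ r : ℕ, IsMaximalRank 2 b c r →
        (b ≤ c + 1 →
          IsMaximalRank 2 b (c + 1) r ∨ IsMaximalRank 2 b (c + 1) (r + 1)) ∧
        (c + 1 < b →
          IsMaximalRank 2 b (c + 1) r ∨ IsMaximalRank 2 b (c + 1) (r + 1) ∨
            IsMaximalRank 2 b (c + 1) (r + 2)) := by
  refine ⟨exists_isMaximalRank b c, fun r hr => ?_⟩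
  obtain ⟨s, hs⟩ := exists_isMaximalRank b (c + 1)
  have hrs := hr.le_succ hs
  obtain ⟨T, hT⟩ := hs.1
  refine ⟨fun hbc => ?_, fun _ => ?_⟩
  · have hle : s ≤ r + 1 := hT ▸ tensorRank_succ_le_add_one hbc hr.tensorRank_le T
    obtain rfl | rfl : s = r ∨ s = r + 1 := by omega
    exacts [.inl hs, .inr hs]
  · have hle : s ≤ r + 2 := hT ▸ tensorRank_succ_le_add_two hr.tensorRank_le T
    obtain rfl | rfl | rfl : s = r ∨ s = r + 1 ∨ s = r + 2 := by omega
    exacts [.inl hs, .inr (.inl hs), .inr (.inr hs)]
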